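/- Conventions. A graph of groups $(\Lambda,\mathscr{L})$ is a connected graph $\Lambda$ with a group $\mathscr{L}_x$ for each vertex and each (unoriented) edge $x$, and a monomorphism $\iota_e\colon\mathscr{L}_e\to\mathscr{L}_{\tau(e)}$ for each oriented edge $e$ with terminal vertex $\tau(e)$. A morphism $f\colon(\Lambda,\mathscr{L})\to(\Gamma,\mathscr{G})$ is a graph morphism that sends vertices to vertices and each edge to an edge or (collapsing it) to a vertex, with homomorphisms $f_x\colon\mathscr{L}_x\to\mathscr{G}_{f(x)}$ and an element $\delta_e\in\mathscr{G}_{f(\tau(e))}$ for each oriented edge $e$, such that $f_{\tau(e)}\iota_e=\mathrm{ad}(\delta_e)\,\iota_{f(e)}f_e$, where $\iota_{f(e)}=\mathrm{id}$ if $e$ is collapsed. It is Stallings if it collapses no edge and all $f_x$ are injective. Two morphisms are equivalent fixing a set $P$ of vertices of $\Lambda$ if the second arises from the first as follows, for some $g_v\in\mathscr{G}_{f(v)}$ with $g_v=1$ for $v\in P$ and some $k_e\in\mathscr{G}_{f(e)}$ (the same for both orientations of $e$): the graph morphism is unchanged, $f_v$ becomes $\mathrm{ad}(g_v)f_v$,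 $f_e$ becomes $\mathrm{ad}(k_e^{-1})f_e$, and $\delta_e$ becomes $g_{\tau(e)}\,\delta_e\,\iota_{f(e)}(k_e)$. Proposition. Let $f\colon(\Lambda,\mathscr{L})\to(\Gamma,\mathscr{G})$ be any morphism of graphs of groups. Let $(\Lambda',\mathscr{L}')$ be obtained from $(\Lambda,\mathscr{L})$ by collapsing each component $C$ of each preimage $f^{-1}(v)$, $v$ a vertex of $\Gamma$: each $C$ becomes a vertex with group $\pi_1(C,\mathscr{L}|_C,b_C)$ for a chosen basepoint $b_C$, each vertex group $\mathscr{L}_w$, $w\in C$, is embedded in it by conjugation with a chosen path from $b_C$ to $w$ in $(C,\mathscr{L}|_C)$ (constant for $w=b_C$), the edges that $f$ does not collapse and their groups remain, and their structure maps are composed with these embeddings. Let $q\colon(\Lambda,\mathscr{L})\to(\Lambda',\mathscr{L}')$ be the quotient morphism: the quotient map on graphs, the embeddings on vertex groups, the identity on the edges that are not collapsed and on their groups, with trivial $\delta$; a collapsed edge $e$ from $w'$ to $w$ (in its chosen orientation) has $q_e=q_w\iota_e$, $\delta_e=1$ and $\delta_{\bar e}=[\gamma_{w'}e\bar\gamma_w]$,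 where $\gamma_w$ is the chosen path to $w$. Then, for all such choices, there is a morphism $f'\colon(\Lambda',\mathscr{L}')\to(\Gamma,\mathscr{G})$ that collapses no edges, such that the following holds. Let $f'(\mathscr{L}')$ be the graph of groups structure on $\Lambda'$ with groups $f'_x(\mathscr{L}'_x)\le\mathscr{G}_{f'(x)}$ and structure maps the restrictions of $\mathrm{ad}(\delta_e)\,\iota_{f'(e)}$, let $f'_*\colon(\Lambda',\mathscr{L}')\to(\Lambda',f'(\mathscr{L}'))$ be the collapse of $\mathscr{L}'$ onto its image (the identity on the graph, $f'_x$ on the groups, trivial elements $\delta$), and let $s\colon(\Lambda',f'(\mathscr{L}'))\to(\Gamma,\mathscr{G})$ be the morphism that is $f'$ on the graph, the inclusion on the groups, and has the elements $\delta_e$ of $f'$. Then $f'=s\circ f'_*$, the morphism $s$ is Stallings, and $s\circ f'_*\circ q$ is equivalent to $f$ fixing all the basepoints $b_C$. -/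

import Mathlib

universe u

/-- A graph (a 1-dimensional CW complex): a type `V` of vertices, a type `E` of edges, each edge
coming with a chosen orientation. The oriented edges are the pairs `(e, b)` with `b : Bool`;
`(e, true)` is `e` with its chosen orientation and `(e, !b)` is the reverse of `(e, b)`.
The terminal vertex `τ(e, b)` is `endpt e b`, hence its initial vertex is `endpt e (!b)`. -/
structure OrGraph where
  V : Type u
  E : Type u
  endpt : E → Bool → V

namespace OrGraph

/-- `x` and `y` are the initial and terminal vertices of some edge from `S`. -/
def AdjIn (Γ : OrGraph.{u}) (S : Set Γ.E) (x y : Γ.V) : Prop :=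
  ∃ e ∈ S, Γ.endpt e false = x ∧ Γ.endpt e true = y

/-- A graph is connected if it is nonempty and any two vertices are joined by an edge path. -/
def Connected (Γ : OrGraph.{u}) : Prop :=
  Nonempty Γ.V ∧ ∀ x y, Relation.EqvGen (Γ.AdjIn Set.univ) x y

/-- The components of the subgraph consisting of all vertices of `Γ` and the edges in `S`. -/
def Comp (Γ : OrGraph.{u}) (S : Set Γ.E) : Type u := Quot (Γ.AdjIn S)

/-- The component containing a vertex. -/
def comp (Γ : OrGraph.{u}) (S : Set Γ.E) (v : Γ.V) : Γ.Comp S := Quot.mk _ v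

theorem comp_endpt (Γ : OrGraph.{u}) {S : Set Γ.E} {e : Γ.E} (he : e ∈ S) (b b' : Bool) :
    Γ.comp S (Γ.endpt e b) = Γ.comp S (Γ.endpt e b') := by
  have h : Γ.comp S (Γ.endpt e false) = Γ.comp S (Γ.endpt e true) :=
    Quot.sound ⟨e, he, rfl, rfl⟩
  cases b <;> cases b' <;> simp [h]

/-- The vertices and the oriented edges of a graph, that is, the underlying set of the graph in
the combinatorial definition through an involution and a retraction. -/
inductive Cell (Γ : OrGraph.{u}) : Type u
  | vert (v : Γ.V) : Cell Γ
  | edge (e : Γ.E) (c : Bool) : Cell Γ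

/-- `x.endpt true` is the terminal vertex `τ(x)` and `x.endpt false` the initial vertex `τ(x̄)`;
both are `v` if `x` is a vertex `v`. -/
def Cell.endpt {Γ : OrGraph.{u}} : Γ.Cell → Bool → Γ.V
  | .vert v, _ => v
  | .edge e c, b => Γ.endpt e (bif c then b else !b)

/-- `x.orient true = x`, and `x.orient false` is the reverse `x̄` of `x`. -/
def Cell.orient {Γ : OrGraph.{u}} : Γ.Cell → Bool → Γ.Cell
  | x, true => x
  | .vert v, false => .vert v
  | .edge e c, false => .edge e (!c)

theorem Cell.endpt_orient {Γ : OrGraph.{u}} (x : Γ.Cell) (c b : Bool) :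
    (x.orient c).endpt b = x.endpt (bif c then b else !b) := by
  cases c <;> cases x <;> try rfl
  rename_i e c
  cases c <;> simp [Cell.orient, Cell.endpt]

end OrGraph

/-- A graph of groups: a connected graph, a group for every vertex and every edge, and for every
oriented edge `(e, b)` a monomorphism from the edge group to the group of the terminal vertex. -/
structure GraphOfGroups extends OrGraph.{u} where
  connected : toOrGraph.Connected
  VG : V → Type u
  EG : E → Type u
  [groupV : ∀ v, Group (VG v)]
  [groupE : ∀ e, Group (EG e)]
  ι : ∀ (e : E) (b : Bool), EG e →* VG (endpt e b)
  ι_injective : ∀ e b, Function.Injective (ι e b)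

attribute [instance] GraphOfGroups.groupV GraphOfGroups.groupE

namespace GraphOfGroups

section Cells

variable (A : GraphOfGroups.{u})

/-- The identification of the groups at two equal vertices. -/
def vcast {v w : A.V} (h : v = w) : A.VG v →* A.VG w := h ▸ MonoidHom.id (A.VG v)

@[simp] theorem vcast_rfl {v : A.V} (h : v = v) (g : A.VG v) : A.vcast h g = g := rfl

theorem vcast_injective {v w : A.V} (h : v = w) : Function.Injective (A.vcast h) := by
  subst h; exact fun _ _ h => h

theorem vcast_vcast {u v w : A.V} (h : u = v) (h' : v = w) (g : A.VG u) :
    A.vcast h' (A.vcast h g) = A.vcast (h.trans h') g := by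
  subst h; subst h'; rfl

/-- The group attached to a vertex or an oriented edge. -/
def grp : A.Cell → Type u
  | .vert v => A.VG v
  | .edge e _ => A.EG e

instance (x : A.Cell) : Group (A.grp x) :=
  match x with
  | .vert v => A.groupV v
  | .edge e _ => A.groupE e

/-- The homomorphism from the group of a cell to the group of its terminal (`b = true`) or
initial (`b = false`) vertex; it is the identity if the cell is a vertex. -/
def cellι : (x : A.Cell) → (b : Bool) → A.grp x →* A.VG (x.endpt b)
  | .vert v, _ => MonoidHom.id (A.VG v)
  | .edge e c, b => A.ι e (bif c then b else !b)

theorem cellι_injective (x : A.Cell) (b : Bool) : Function.Injective (A.cellι x b) := by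
  cases x with
  | vert v => exact fun _ _ h => h
  | edge e c => exact A.ι_injective e _

/-- An oriented edge and its reverse carry the same group. -/
def grpOrient : (x : A.Cell) → (c : Bool) → A.grp x →* A.grp (x.orient c)
  | x, true => MonoidHom.id (A.grp x)
  | .vert v, false => MonoidHom.id (A.VG v)
  | .edge e _, false => MonoidHom.id (A.EG e)

theorem cellι_orient (x : A.Cell) (c b : Bool) (h : A.grp x) {w : A.V}
    (hw : (x.orient c).endpt b = w) :
    A.vcast hw (A.cellι (x.orient c) b (A.grpOrient x c h)) =
      A.vcast ((x.endpt_orient c b).symm.trans hw) (A.cellι x (bif c then b else !b) h) := by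
  subst hw
  cases c
  · cases x with
    | vert v => rfl
    | edge e c => cases c <;> cases b <;> rfl
  · rfl

end Cells

/-- The part of a morphism of graphs of groups (with given vertex maps `onV`, `vhom`) that
concerns one edge `e`: its image `cell`, which is a vertex if `e` is collapsed and an oriented
edge otherwise; the homomorphism `hom` of the edge group; and for each of the two orientations
`(e, b)` of `e`, with terminal vertex `v`, the element `δ b`, such that
`vhom v ∘ ι = ad (δ b) ∘ ι' ∘ hom`, where `ι` and `ι'` are the structure maps of `(e, b)` and of
its image (the identity if `e` is collapsed). -/
structure EdgeMap (A B : GraphOfGroups.{u}) (onV : A.V → B.V)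
    (vhom : ∀ v, A.VG v →* B.VG (onV v)) (e : A.E) where
  cell : B.Cell
  ends : ∀ b, cell.endpt b = onV (A.endpt e b)
  hom : A.EG e →* B.grp cell
  δ : ∀ b, B.VG (onV (A.endpt e b))
  natural : ∀ (b : Bool) (h : A.EG e),
    vhom _ (A.ι e b h) = δ b * B.vcast (ends b) (B.cellι cell b (hom h)) * (δ b)⁻¹

/-- A morphism of graphs of groups: a morphism of graphs that may collapse edges to vertices,
homomorphisms of vertex and edge groups, and an element `δ` for each oriented edge, such that the
pseudonaturality condition holds. -/
structure Morphism (A B : GraphOfGroups.{u}) where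
  onV : A.V → B.V
  vhom : ∀ v, A.VG v →* B.VG (onV v)
  edge : ∀ e, EdgeMap A B onV vhom e

namespace Morphism

variable {A B C : GraphOfGroups.{u}}

/-- The morphism collapses the edge `e` to a vertex. -/
def Collapses (f : Morphism A B) (e : A.E) : Prop := ∃ w, (f.edge e).cell = .vert w

/-- A morphism is Stallings if it does not collapse edges and all its homomorphisms of vertex and
edge groups are injective. -/
def IsStallings (f : Morphism A B) : Prop :=
  (∀ e, ¬ f.Collapses e) ∧ (∀ v, Function.Injective (f.vhom v)) ∧
    ∀ e, Function.Injective (f.edge e).hom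

theorem vhom_vcast (f : Morphism A B) {v w : A.V} (h : v = w) (g : A.VG v) :
    f.vhom w (A.vcast h g) = B.vcast (congrArg f.onV h) (f.vhom v g) := by
  subst h; rfl

/-- The action of a morphism on vertices and oriented edges. -/
def cellMap (f : Morphism A B) : A.Cell → B.Cell
  | .vert v => .vert (f.onV v)
  | .edge e c => (f.edge e).cell.orient c

/-- The homomorphism at a vertex or an oriented edge. -/
def cellHom (f : Morphism A B) : (x : A.Cell) → A.grp x →* B.grp (f.cellMap x)
  | .vert v => f.vhom v
  | .edge e c => (B.grpOrient (f.edge e).cell c).comp (f.edge e).hom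

/-- The element `δ` of an oriented edge (`b = true`) or of its reverse (`b = false`), and `1` for
a vertex. -/
def cellδ (f : Morphism A B) : (x : A.Cell) → (b : Bool) → B.VG (f.onV (x.endpt b))
  | .vert _, _ => 1
  | .edge e c, b => (f.edge e).δ (bif c then b else !b)

theorem cell_ends (f : Morphism A B) (x : A.Cell) (b : Bool) :
    (f.cellMap x).endpt b = f.onV (x.endpt b) := by
  cases x with
  | vert v => rfl
  | edge e c => exact (OrGraph.Cell.endpt_orient _ c b).trans ((f.edge e).ends _)

theorem cell_natural (f : Morphism A B) (x : A.Cell) (b : Bool) (h : A.grp x) :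
    f.vhom _ (A.cellι x b h) = f.cellδ x b *
      B.vcast (f.cell_ends x b) (B.cellι (f.cellMap x) b (f.cellHom x h)) * (f.cellδ x b)⁻¹ := by
  cases x with
  | vert v => exact (by simp : f.vhom v h = 1 * f.vhom v h * 1⁻¹)
  | edge e c =>
    have h1 := (f.edge e).natural (bif c then b else !b) h
    have h2 := B.cellι_orient (f.edge e).cell c b ((f.edge e).hom h)
      (f.cell_ends (.edge e c) b)
    exact h1.trans (congrArg (fun t => f.cellδ (.edge e c) b * t * (f.cellδ (.edge e c) b)⁻¹)
      h2.symm)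

/-- The composition of a morphism with the part of another morphism that concerns one edge; on
the elements `δ` it is `δ^{gf}_e = g(δ^f_e) δ^g_{f(e)}`, where `δ^g_{f(e)} = 1` if `f` collapses
`e`. -/
def compEdge (g : Morphism B C) {onV : A.V → B.V} {vhom : ∀ v, A.VG v →* B.VG (onV v)} {e : A.E}
    (d : EdgeMap A B onV vhom e) :
    EdgeMap A C (fun v => g.onV (onV v)) (fun v => (g.vhom (onV v)).comp (vhom v)) e where
  cell := g.cellMap d.cell
  ends b := (g.cell_ends _ b).trans (congrArg g.onV (d.ends b))
  hom := (g.cellHom d.cell).comp d.hom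
  δ b := g.vhom _ (d.δ b) * C.vcast (congrArg g.onV (d.ends b)) (g.cellδ d.cell b)
  natural b h := by
    have h1 := congrArg (g.vhom _) (d.natural b h)
    simp only [map_mul, map_inv, vhom_vcast, cell_natural, vcast_vcast] at h1
    simp only [MonoidHom.comp_apply, h1]
    group

/-- Composition of morphisms. -/
def comp (g : Morphism B C) (f : Morphism A B) : Morphism A C where
  onV v := g.onV (f.onV v)
  vhom v := (g.vhom (f.onV v)).comp (f.vhom v)
  edge e := g.compEdge (f.edge e)

/-- Replace `f_v` by `ad (g v) ∘ f_v` and `f_e` by `ad (k e)⁻¹ ∘ f_e`, and `δ_e` by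
`g v * δ_e * ι (k e)` for every oriented edge `e` with terminal vertex `v`. -/
def twist (f : Morphism A B) (g : ∀ v, B.VG (f.onV v)) (k : ∀ e, B.grp (f.edge e).cell) :
    Morphism A B where
  onV := f.onV
  vhom v := (MulAut.conj (g v)).toMonoidHom.comp (f.vhom v)
  edge e :=
    { cell := (f.edge e).cell
      ends := (f.edge e).ends
      hom := (MulAut.conj (k e)⁻¹).toMonoidHom.comp (f.edge e).hom
      δ := fun b => g _ * (f.edge e).δ b *
        B.vcast ((f.edge e).ends b) (B.cellι (f.edge e).cell b (k e))
      natural := fun b h => by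
        simp only [MonoidHom.comp_apply, MulEquiv.toMonoidHom_eq_coe, MonoidHom.coe_coe,
          MulAut.conj_apply, (f.edge e).natural b h]
        simp only [map_mul, map_inv]
        group }

/-- Two morphisms are equivalent fixing a set `P` of vertices if one is obtained from the other by
changing the `f_v` with `v ∉ P` (and the `f_e` of arbitrary edges) by inner automorphisms, together
with the corresponding changes of the elements `δ`. -/
def EquivFixing (f f' : Morphism A B) (P : Set A.V) : Prop :=
  ∃ (g : ∀ v, B.VG (f.onV v)) (k : ∀ e, B.grp (f.edge e).cell),
    (∀ v ∈ P, g v = 1) ∧ f' = f.twist g k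

end Morphism

/-- Paths `g₁ e₁ g₂ e₂ ⋯ eₖ gₖ₊₁` in a graph of groups, with endpoints at vertices, all of whose
edges `eᵢ` lie in `S`. Here `cons g e _ b _ p` is the path `g (e, b) p`. -/
inductive Path (A : GraphOfGroups.{u}) (S : Set A.E) : A.V → A.V → Type u
  | pt {v : A.V} (g : A.VG v) : Path A S v v
  | cons {v w : A.V} (g : A.VG v) (e : A.E) (he : e ∈ S) (b : Bool) (hv : A.endpt e (!b) = v)
      (p : Path A S (A.endpt e b) w) : Path A S v w

namespace Path

variable {A : GraphOfGroups.{u}} {S : Set A.E}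

/-- Multiply the first group element of a path from the left. -/
def lmul {v w : A.V} (g : A.VG v) : Path A S v w → Path A S v w
  | .pt g' => .pt (g * g')
  | .cons g' e he b hv p => .cons (g * g') e he b hv p

/-- Concatenation of paths. -/
def append {u v w : A.V} : Path A S u v → Path A S v w → Path A S u w
  | .pt g, q => q.lmul g
  | .cons g e he b hv p, q => .cons g e he b hv (p.append q)

/-- The path with the opposite orientation. -/
def reverse {v w : A.V} : Path A S v w → Path A S w v
  | .pt g => .pt g⁻¹
  | .cons g e he b hv p =>
      p.reverse.append (.cons 1 e he (!b) (by rw [Bool.not_not])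
        (hv ▸ (.pt (A.vcast hv.symm g⁻¹) : Path A S (A.endpt e (!b)) (A.endpt e (!b)))))

/-- Homotopy rel endpoints: the equivalence relation generated by the removal of subpaths
`e ē` and by the replacement of `g e ι_e(h) g'` by `g ι_ē(h) e g'`. -/
inductive Homotopic : {v w : A.V} → Path A S v w → Path A S v w → Prop
  | refl {v w : A.V} (p : Path A S v w) : Homotopic p p
  | symm {v w : A.V} {p q : Path A S v w} : Homotopic p q → Homotopic q p
  | trans {v w : A.V} {p q r : Path A S v w} : Homotopic p q → Homotopic q r → Homotopic p r
  | congr {v w : A.V} (g : A.VG v) (e : A.E) (he : e ∈ S) (b : Bool)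
      (hv : A.endpt e (!b) = v) {p q : Path A S (A.endpt e b) w} :
      Homotopic p q → Homotopic (.cons g e he b hv p) (.cons g e he b hv q)
  | cancel {w : A.V} (e : A.E) (he : e ∈ S) (b : Bool) (g : A.VG (A.endpt e (!b)))
      (hv : A.endpt e (!!b) = A.endpt e b) (p : Path A S (A.endpt e (!b)) w) :
      Homotopic (.cons g e he b rfl (.cons 1 e he (!b) hv p)) (p.lmul g)
  | slide {w : A.V} (e : A.E) (he : e ∈ S) (b : Bool) (g : A.VG (A.endpt e (!b)))
      (h : A.EG e) (p : Path A S (A.endpt e b) w) :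
      Homotopic (.cons g e he b rfl (p.lmul (A.ι e b h)))
        (.cons (g * A.ι e (!b) h) e he b rfl p)

theorem lmul_one {v w : A.V} (p : Path A S v w) : p.lmul 1 = p := by
  cases p <;> simp [lmul]

theorem lmul_lmul {v w : A.V} (g g' : A.VG v) (p : Path A S v w) :
    (p.lmul g').lmul g = p.lmul (g * g') := by
  cases p <;> simp [lmul, mul_assoc]

theorem lmul_append {u v w : A.V} (g : A.VG u) (p : Path A S u v) (q : Path A S v w) :
    (p.lmul g).append q = (p.append q).lmul g := by
  cases p with
  | pt g' => exact (lmul_lmul g g' q).symm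
  | cons g' e he b hv p => rfl

theorem append_assoc {t u v w : A.V} (p : Path A S t u) (q : Path A S u v)
    (r : Path A S v w) : (p.append q).append r = p.append (q.append r) := by
  induction p with
  | pt g => simp [append, lmul_append]
  | cons g e he b hv p ih => simp [append, ih]

theorem append_one {v w : A.V} (p : Path A S v w) : p.append (.pt 1) = p := by
  induction p with
  | pt g => simp [append, lmul]
  | cons g e he b hv p ih => simp [append, ih]

theorem Homotopic.lmul {v w : A.V} {p q : Path A S v w} (h : Homotopic p q) (g : A.VG v) :
    Homotopic (p.lmul g) (q.lmul g) := by
  induction h with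
  | refl p => exact .refl _
  | symm _ ih => exact .symm (ih g)
  | trans _ _ ih ih' => exact .trans (ih g) (ih' g)
  | congr g' e he b hv h _ => exact .congr _ e he b hv h
  | cancel e he b g' hv p =>
    rw [lmul_lmul]
    exact .cancel e he b (g * g') hv p
  | slide e he b g' h p =>
    have := Homotopic.slide e he b (g * g') h p
    rw [mul_assoc] at this
    exact this

theorem Homotopic.append_right {u v w : A.V} {p p' : Path A S u v} (h : Homotopic p p')
    (q : Path A S v w) : Homotopic (p.append q) (p'.append q) := by
  induction h with
  | refl p => exact .refl _
  | symm _ ih => exact .symm (ih q)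
  | trans _ _ ih ih' => exact .trans (ih q) (ih' q)
  | congr g' e he b hv h ih => exact .congr _ e he b hv (ih q)
  | cancel e he b g' hv p =>
    rw [lmul_append]
    exact .cancel e he b g' hv (p.append q)
  | slide e he b g' h p =>
    have := Homotopic.slide e he b g' h (p.append q)
    rw [← lmul_append] at this
    exact this

theorem Homotopic.append_left {u v w : A.V} (p : Path A S u v) {q q' : Path A S v w}
    (h : Homotopic q q') : Homotopic (p.append q) (p.append q') := by
  induction p with
  | pt g => exact h.lmul g
  | cons g e he b hv p ih => exact .congr g e he b hv (ih h)

theorem Homotopic.append_reverse {v w : A.V} (p : Path A S v w) :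
    Homotopic (p.append p.reverse) (.pt 1) := by
  induction p with
  | pt g =>
    have h : ((Path.pt g : Path A S _ _).append (Path.pt g).reverse) = .pt 1 := by
      simp [append, reverse, Path.lmul]
    rw [h]
    exact .refl _
  | cons g e he b hv p ih =>
    subst hv
    simp only [reverse, append, ← append_assoc]
    refine .trans (.congr g e he b rfl (ih.append_right _)) ?_
    have := Homotopic.cancel e he b g (by rw [Bool.not_not])
      (Path.pt g⁻¹ : Path A S (A.endpt e (!b)) (A.endpt e (!b)))
    simpa [append, Path.lmul] using this

theorem Homotopic.reverse_append {v w : A.V} (p : Path A S v w) :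
    Homotopic (p.reverse.append p) (.pt 1) := by
  induction p with
  | pt g =>
    have h : ((Path.pt g : Path A S _ _).reverse.append (Path.pt g)) = .pt 1 := by
      simp [append, reverse, Path.lmul]
    rw [h]
    exact .refl _
  | cons g e he b hv p ih =>
    subst hv
    simp only [reverse, append, append_assoc]
    refine .trans (.append_left _ (q' := p) ?_) ih
    cases b
    · have := Homotopic.cancel e he true 1 rfl p
      rw [lmul_one] at this
      simp only [Path.lmul, vcast_rfl, inv_mul_cancel]
      exact this
    · have := Homotopic.cancel e he false 1 rfl p
      rw [lmul_one] at this
      simp only [Path.lmul, vcast_rfl, inv_mul_cancel]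
      exact this

end Path

/-- Homotopy classes rel endpoints of paths with edges in `S`. -/
def HPath (A : GraphOfGroups.{u}) (S : Set A.E) (v w : A.V) : Type u :=
  Quot (Path.Homotopic (A := A) (S := S) (v := v) (w := w))

namespace HPath

variable {A : GraphOfGroups.{u}} {S : Set A.E}

/-- The class of a path. -/
def mk {v w : A.V} (p : Path A S v w) : HPath A S v w := Quot.mk _ p

/-- Concatenation. -/
def trans {u v w : A.V} (x : HPath A S u v) (y : HPath A S v w) : HPath A S u w :=
  Quot.map₂ Path.append (fun p _ _ h => .append_left p h) (fun _ _ q h => h.append_right q) x y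

/-- The class of a group element of a vertex group. -/
def ofVert (S : Set A.E) {v : A.V} (g : A.VG v) : HPath A S v v := mk (.pt g)

/-- The class of the oriented edge `(e, b)`. -/
def ofEdge {e : A.E} (he : e ∈ S) (b : Bool) : HPath A S (A.endpt e (!b)) (A.endpt e b) :=
  mk (.cons 1 e he b rfl (.pt 1))

/-- The class of the constant path, for equal endpoints. -/
def const (S : Set A.E) {v w : A.V} (h : v = w) : HPath A S v w := h ▸ ofVert S 1

theorem trans_assoc {t u v w : A.V} (x : HPath A S t u) (y : HPath A S u v) (z : HPath A S v w) :
    (x.trans y).trans z = x.trans (y.trans z) := by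
  induction x using Quot.ind
  induction y using Quot.ind
  induction z using Quot.ind
  exact congrArg mk (Path.append_assoc _ _ _)

theorem one_trans {v w : A.V} (x : HPath A S v w) : (ofVert S 1).trans x = x := by
  induction x using Quot.ind
  exact congrArg mk (Path.lmul_one _)

theorem trans_one {v w : A.V} (x : HPath A S v w) : x.trans (ofVert S 1) = x := by
  induction x using Quot.ind
  exact congrArg mk (Path.append_one _)

theorem mk_reverse_eq {v w : A.V} {p q : Path A S v w} (h : p.Homotopic q) :
    mk p.reverse = mk q.reverse := by
  have h1 : (mk p.reverse).trans (mk p) = ofVert S 1 :=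
    Quot.sound (Path.Homotopic.reverse_append p)
  have h2 : (mk q).trans (mk q.reverse) = ofVert S 1 :=
    Quot.sound (Path.Homotopic.append_reverse q)
  have h3 : mk p = mk q := Quot.sound h
  rw [← trans_one (mk p.reverse), ← h2, ← trans_assoc, ← h3, h1, one_trans]

/-- The reversed class. -/
def symm {v w : A.V} (x : HPath A S v w) : HPath A S w v :=
  Quot.lift (fun p => mk p.reverse) (fun _ _ h => mk_reverse_eq h) x

theorem symm_trans {v w : A.V} (x : HPath A S v w) : x.symm.trans x = ofVert S 1 := by
  induction x using Quot.ind
  exact Quot.sound (Path.Homotopic.reverse_append _)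

theorem trans_symm {v w : A.V} (x : HPath A S v w) : x.trans x.symm = ofVert S 1 := by
  induction x using Quot.ind
  exact Quot.sound (Path.Homotopic.append_reverse _)

theorem ofVert_mul {v : A.V} (g g' : A.VG v) :
    ofVert S (g * g') = (ofVert S g).trans (ofVert S g') := rfl

/-- `ι_ē(h) e = e ι_e(h)`. -/
theorem slide {e : A.E} (he : e ∈ S) (b : Bool) (h : A.EG e) :
    (ofVert S (A.ι e (!b) h)).trans (ofEdge he b) =
      (ofEdge he b).trans (ofVert S (A.ι e b h)) := by
  have := Path.Homotopic.slide e he b 1 h (.pt 1 : Path A S _ _)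
  have h1 : mk _ = mk _ := (Quot.sound this).symm
  simp only [Path.lmul, one_mul, mul_one] at h1
  change mk (Path.lmul _ (.cons 1 e he b rfl (.pt 1))) =
    mk (.cons 1 e he b rfl (Path.lmul 1 (.pt (A.ι e b h))))
  simp only [Path.lmul, one_mul, mul_one]
  exact h1

end HPath

/-- The fundamental group, based at `v`, of the component containing `v` of the subgraph of groups
with edge set `S`: homotopy classes of loops at `v` with edges in `S` (a loop at `v` cannot leave
the component), under concatenation. For `S = Set.univ` it is the fundamental group of `A`. -/
def Pi1 (A : GraphOfGroups.{u}) (S : Set A.E) (v : A.V) : Type u := HPath A S v v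

instance (A : GraphOfGroups.{u}) (S : Set A.E) (v : A.V) : Group (Pi1 A S v) where
  mul x y := HPath.trans x y
  one := HPath.ofVert S 1
  inv x := HPath.symm x
  mul_assoc := HPath.trans_assoc
  one_mul := HPath.one_trans
  mul_one := HPath.trans_one
  inv_mul_cancel := HPath.symm_trans

section Injectivity

/-- Equivariant comparison of `G × (ℕ → Z)` and `H × (ℕ → Z)` for a subgroup `H` of `G` and a
sufficiently large set `Z`. -/
theorem exists_equivariant {G H Z : Type u} [Group G] [Group H] (j : H →* G)
    (hj : Function.Injective j) (i : G → Z) (hi : Function.Injective i) :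
    ∃ Φ : G × (ℕ → Z) ≃ H × (ℕ → Z), ∀ (h : H) (g : G) (k : ℕ → Z),
      Φ (j h * g, k) = (h * (Φ (g, k)).1, (Φ (g, k)).2) := by
  let Q := Quotient (QuotientGroup.rightRel j.range)
  have key : ∀ (h : H) (q : Q), (Quotient.mk _ (j h * q.out) : Q) = q := by
    intro h q
    conv_rhs => rw [← q.out_eq]
    apply Quotient.sound
    change QuotientGroup.rightRel j.range _ _
    rw [QuotientGroup.rightRel_apply]
    exact ⟨h⁻¹, by simp⟩
  let θ : H × Q → G := fun x => j x.1 * x.2.out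
  have hθ : Function.Bijective θ := by
    constructor
    · rintro ⟨h, q⟩ ⟨h', q'⟩ hh
      have hq : q = q' := by
        rw [← key h q, ← key h' q']
        exact congrArg _ hh
      subst hq
      have : j h = j h' := mul_right_cancel hh
      rw [hj this]
    · intro g
      have h0 : QuotientGroup.rightRel j.range (Quotient.mk _ g : Q).out g :=
        Quotient.exact (Quotient.out_eq (Quotient.mk _ g : Q))
      rw [QuotientGroup.rightRel_apply] at h0
      obtain ⟨h, hh⟩ := h0
      exact ⟨(h, Quotient.mk _ g), by simp [θ, hh]⟩
  obtain ⟨σ⟩ : Nonempty (Q × (ℕ → Z) ≃ (ℕ → Z)) := by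
    let a : Q × (ℕ → Z) → (ℕ → Z) := fun x n => Nat.casesOn n (i x.1.out) x.2
    let b : (ℕ → Z) → Q × (ℕ → Z) := fun x => (Quotient.mk _ 1, x)
    have ha : Function.Injective a := by
      rintro ⟨q, x⟩ ⟨q', x'⟩ h
      have h0 : i q.out = i q'.out := congrFun h 0
      have h1 : x = x' := funext fun n => congrFun h (n + 1)
      rw [Quotient.out_injective (hi h0), h1]
    have hb : Function.Injective b := fun x y h => congrArg Prod.snd h
    obtain ⟨F, hF⟩ := Function.Embedding.schroeder_bernstein ha hb
    exact ⟨Equiv.ofBijective F hF⟩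
  let Θ := Equiv.ofBijective θ hθ
  refine ⟨(Θ.symm.prodCongr (Equiv.refl _)).trans
    ((Equiv.prodAssoc _ _ _).trans ((Equiv.refl _).prodCongr σ)), ?_⟩
  intro h g k
  obtain ⟨⟨h', q⟩, rfl⟩ := Θ.surjective g
  have : j h * Θ (h', q) = Θ (h * h', q) := by simp [Θ, θ, mul_assoc]
  simp [this]

/-- A vertex group embeds in the fundamental group. -/
theorem ofVert_injective (A : GraphOfGroups.{u}) (S : Set A.E) (v : A.V) :
    Function.Injective (fun g : A.VG v => HPath.ofVert S g) := by
  classical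
  let Z := Σ v, A.VG v
  have hi : ∀ v, Function.Injective (fun g : A.VG v => (⟨v, g⟩ : Z)) :=
    fun v => sigma_mk_injective
  choose Φ hΦ using fun (e : A.E) (b : Bool) =>
    exists_equivariant (A.ι e b) (A.ι_injective e b) (fun g => (⟨_, g⟩ : Z)) (hi _)
  have hΦ' : ∀ e b h x, Φ e b (A.ι e b h * x.1, x.2) = (h * (Φ e b x).1, (Φ e b x).2) :=
    fun e b h x => hΦ e b h x.1 x.2
  have hΦs : ∀ e b h (y : A.EG e × (ℕ → Z)), (Φ e b).symm (h * y.1, y.2) =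
      (A.ι e b h * ((Φ e b).symm y).1, ((Φ e b).symm y).2) := by
    intro e b h y
    rw [Equiv.symm_apply_eq, hΦ']
    simp
  let act : ∀ {v w : A.V}, Path A S v w → A.VG w × (ℕ → Z) → A.VG v × (ℕ → Z) :=
    fun {v w} p => Path.rec (motive := fun v w _ => A.VG w × (ℕ → Z) → A.VG v × (ℕ → Z))
      (fun g x => (g * x.1, x.2))
      (fun g e _ b hv _ ih x =>
        let y := (Φ e (!b)).symm (Φ e b (ih x))
        (g * A.vcast hv y.1, y.2)) p
  have act_lmul : ∀ {v w : A.V} (p : Path A S v w) (g : A.VG v) (x),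
      act (p.lmul g) x = (g * (act p x).1, (act p x).2) := by
    intro v w p g x
    cases p <;> simp [act, Path.lmul, mul_assoc]
  have act_htpy : ∀ {v w : A.V} (p q : Path A S v w), p.Homotopic q → act p = act q := by
    intro v w p q h
    induction h with
    | refl p => rfl
    | symm _ ih => exact ih.symm
    | trans _ _ ih ih' => exact ih.trans ih'
    | congr g e he b hv h ih =>
      funext x
      have := congrFun ih x
      simp only [act] at this ⊢
      rw [this]
    | cancel e he b g hv p =>
      funext x
      rw [act_lmul]
      have k : ∀ b' y, (Φ e b').symm (Φ e b ((Φ e b).symm (Φ e b' y))) = y := by simp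
      simp only [act, one_mul]
      cases b
      · exact congrArg (fun y => (g * y.1, y.2)) (k true _)
      · exact congrArg (fun y => (g * y.1, y.2)) (k false _)
    | slide e he b g h p =>
      funext x
      have h1 := act_lmul p (A.ι e b h) x
      simp only [act] at h1 ⊢
      rw [h1, hΦ', hΦs]
      simp [mul_assoc]
  intro g g' hg
  have h1 : act (.pt g : Path A S v v) = act (.pt g') :=
    congrArg (Quot.lift (fun p : Path A S v v => act p) (fun p q h => act_htpy p q h)) hg
  have h2 := congrFun h1 (1, fun _ => ⟨v, 1⟩)
  simpa [act] using congrArg Prod.fst h2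

end Injectivity

/-- The choices involved in collapsing every component of the subgraph of groups consisting of all
vertices and the edges in `S`: a basepoint in each component, and for each vertex `v` a (homotopy
class of a) path in its component from the basepoint to `v`, constant if `v` is the basepoint. -/
structure CollapseChoice (A : GraphOfGroups.{u}) (S : Set A.E) where
  base : A.Comp S → A.V
  base_mem : ∀ K, A.comp S (base K) = K
  path : ∀ v, HPath A S (base (A.comp S v)) v
  path_base : ∀ v (h : base (A.comp S v) = v), path v = HPath.const S h

/-- Choices exist, and any given vertex can be one of the basepoints. -/
theorem exists_collapseChoice (A : GraphOfGroups.{u}) (S : Set A.E) (p : A.V) :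
    ∃ c : CollapseChoice A S, p ∈ Set.range c.base := by
  classical
  have h1 : ∀ v w, Relation.EqvGen (A.AdjIn S) v w → Nonempty (HPath A S v w) := by
    intro v w h
    induction h with
    | rel x y h =>
      obtain ⟨e, he, rfl, rfl⟩ := h
      exact ⟨HPath.ofEdge he true⟩
    | refl x => exact ⟨HPath.const S rfl⟩
    | symm x y _ ih => exact ih.map HPath.symm
    | trans x y z _ _ ih ih' => exact ⟨ih.some.trans ih'.some⟩
  let β : A.Comp S → A.V := fun K => if A.comp S p = K then p else Quot.out K
  have hβ : ∀ K, A.comp S (β K) = K := by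
    intro K
    by_cases h : A.comp S p = K
    · simp only [β, if_pos h]; exact h
    · simp only [β, if_neg h]; exact Quot.out_eq K
  have h2 : ∀ v, Nonempty (HPath A S (β (A.comp S v)) v) := fun v =>
    h1 _ _ (Quot.eqvGen_exact (hβ (A.comp S v)))
  exact ⟨
    { base := β
      base_mem := hβ
      path := fun v => if h : β (A.comp S v) = v then HPath.const S h else (h2 v).some
      path_base := fun v h => dif_pos h }, A.comp S p, if_pos rfl⟩

namespace CollapseChoice

variable {A : GraphOfGroups.{u}} {S : Set A.E} (c : CollapseChoice A S)

/-- The embedding of the vertex group at `v` in the fundamental group of the component of `v`, by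
conjugation with the chosen path. -/
def vertHom (v : A.V) : A.VG v →* Pi1 A S (c.base (A.comp S v)) where
  toFun g := ((c.path v).trans (HPath.ofVert S g)).trans (c.path v).symm
  map_one' := by
    rw [HPath.trans_one, HPath.trans_symm]; rfl
  map_mul' g g' := by
    change _ = HPath.trans _ _
    simp only [HPath.ofVert_mul, HPath.trans_assoc]
    rw [← HPath.trans_assoc (c.path v).symm (c.path v), HPath.symm_trans, HPath.one_trans]

theorem vertHom_injective (v : A.V) : Function.Injective (c.vertHom v) := by
  intro g g' h
  apply ofVert_injective A S v
  have h' : ((c.path v).trans (HPath.ofVert S g)).trans (c.path v).symm =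
    ((c.path v).trans (HPath.ofVert S g')).trans (c.path v).symm := h
  have h'' := congrArg (fun x => ((c.path v).symm.trans x).trans (c.path v)) h'
  simp only [HPath.trans_assoc, HPath.symm_trans, HPath.trans_one] at h''
  simpa only [← HPath.trans_assoc, HPath.symm_trans, HPath.one_trans] using h''

/-- The graph of groups obtained from `A` by collapsing each component of the subgraph with edge
set `S`: each component becomes a vertex whose group is the fundamental group of the component,
the other edges and their groups remain, and the structure maps are composed with the embeddings
of the old vertex groups in the new ones. -/
def collapse : GraphOfGroups.{u} where
  V := A.Comp S
  E := {e : A.E // e ∉ S}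
  endpt e b := A.comp S (A.endpt e.1 b)
  connected := by
    refine ⟨A.connected.1.map (A.comp S), fun x y => ?_⟩
    induction x using Quot.ind with | mk x => ?_
    induction y using Quot.ind with | mk y => ?_
    induction A.connected.2 x y with
    | rel x y h =>
      obtain ⟨e, -, rfl, rfl⟩ := h
      by_cases he : e ∈ S
      · have h := A.comp_endpt he false true
        unfold OrGraph.comp at h
        rw [h]
        exact .refl _
      · exact .rel _ _ ⟨⟨e, he⟩, trivial, rfl, rfl⟩
    | refl x => exact .refl _
    | symm x y _ ih => exact .symm _ _ ih
    | trans x y z _ _ ih ih' => exact .trans _ _ _ ih ih'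
  VG K := Pi1 A S (c.base K)
  EG e := A.EG e.1
  ι e b := (c.vertHom (A.endpt e.1 b)).comp (A.ι e.1 b)
  ι_injective e b := (c.vertHom_injective _).comp (A.ι_injective e.1 b)

/-- The vertex of the collapsed graph given by the component of `v`. -/
def vtx (v : A.V) : c.collapse.V := A.comp S v

theorem vtx_endpt {e : A.E} (he : e ∈ S) (b b' : Bool) :
    c.vtx (A.endpt e b) = c.vtx (A.endpt e b') :=
  A.comp_endpt he b b'

/-- `vertHom`, as a homomorphism to the vertex group of the collapsed graph of groups. -/
def collapseHom (v : A.V) : A.VG v →* c.collapse.VG (c.vtx v) := c.vertHom v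

/-- The element `[γ e γ'⁻¹]` of the fundamental group of the component of `(e, b)`, where `γ` and
`γ'` are the chosen paths to the initial and the terminal vertex of `(e, b)`. -/
def edgeElt {e : A.E} (he : e ∈ S) (b : Bool) : c.collapse.VG (c.vtx (A.endpt e (!b))) :=
  (((c.path (A.endpt e (!b))).trans (HPath.ofEdge he b)).trans (c.path (A.endpt e b)).symm).trans
    (HPath.const S (congrArg c.base (A.comp_endpt he b (!b))))

theorem edgeElt_mul {e : A.E} (he : e ∈ S) (b : Bool) (h : A.EG e) :
    c.collapseHom _ (A.ι e (!b) h) = c.edgeElt he b *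
      c.collapse.vcast (c.vtx_endpt he b (!b)) (c.collapseHom _ (A.ι e b h)) *
      (c.edgeElt he b)⁻¹ := by
  have cast_eq : ∀ {K K' : c.collapse.V} (hK : K = K') (x : c.collapse.VG K),
      (HPath.const S (congrArg c.base hK)).trans (c.collapse.vcast hK x) =
        HPath.trans x (HPath.const S (congrArg c.base hK)) := by
    intro K K' hK x
    subst hK
    exact (HPath.one_trans _).trans (HPath.trans_one _).symm
  have key : ∀ {p q v w : A.V} (γ : HPath A S p v) (γ' : HPath A S q w) (ε : HPath A S v w)
      (κ : HPath A S q p) (g : HPath A S v v) (g' : HPath A S w w) (x : HPath A S p p),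
      g.trans ε = ε.trans g' → κ.trans x = ((γ'.trans g').trans γ'.symm).trans κ →
      ((γ.trans g).trans γ.symm).trans (((γ.trans ε).trans γ'.symm).trans κ) =
        (((γ.trans ε).trans γ'.symm).trans κ).trans x := by
    intro p q v w γ γ' ε κ g g' x h1 h2
    rw [HPath.trans_assoc _ κ, h2]
    simp only [HPath.trans_assoc]
    rw [← HPath.trans_assoc γ.symm γ, HPath.symm_trans, HPath.one_trans,
      ← HPath.trans_assoc γ'.symm γ', HPath.symm_trans, HPath.one_trans,
      ← HPath.trans_assoc g ε, h1, HPath.trans_assoc]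
  rw [eq_mul_inv_iff_mul_eq]
  exact key _ _ _ _ _ _ _ (HPath.slide he b h) (cast_eq (c.vtx_endpt he b (!b)) _)

/-- The quotient morphism on a collapsed edge `e`: it goes to the vertex given by its component;
`δ` is trivial for `(e, true)` and `[γ e γ'⁻¹]` for `(e, false)`. -/
def quotientEdgeOfMem {e : A.E} (he : e ∈ S) : EdgeMap A c.collapse c.vtx c.collapseHom e where
  cell := .vert (c.vtx (A.endpt e true))
  ends b := c.vtx_endpt he true b
  hom := (c.collapseHom _).comp (A.ι e true)
  δ b := match b with
    | true => 1
    | false => c.edgeElt he true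
  natural b h := by
    cases b
    · exact c.edgeElt_mul he true h
    · simp only [one_mul, inv_one, mul_one]; rfl

/-- The quotient morphism on an edge that is not collapsed. -/
def quotientEdgeOfNotMem {e : A.E} (he : e ∉ S) :
    EdgeMap A c.collapse c.vtx c.collapseHom e where
  cell := .edge ⟨e, he⟩ true
  ends _ := rfl
  hom := MonoidHom.id _
  δ _ := 1
  natural b h := by
    simp only [one_mul, inv_one, mul_one]; rfl

open Classical in
/-- The quotient morphism from `A` to the graph of groups obtained by collapsing. On paths it is
`g ↦ γ_v g γ_v⁻¹` for `g` in the group of a vertex `v`, it maps a collapsed edge `e` from `v` to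
`w` to `[γ_v e γ_w⁻¹]`, and it is the identity on all other edges. -/
noncomputable def quotientMap : Morphism A c.collapse where
  onV := c.vtx
  vhom := c.collapseHom
  edge e := if he : e ∈ S then c.quotientEdgeOfMem he else c.quotientEdgeOfNotMem he

end CollapseChoice

namespace Morphism

variable {A B : GraphOfGroups.{u}} (f : Morphism A B)

/-- The edges collapsed by `f`. Together with all vertices of `A` they form the union of the
preimages `f⁻¹(v)`, `v` a vertex of `B`, and the components of this subgraph are the components of
the preimages. -/
def collapsedEdges : Set A.E := {e | f.Collapses e}

/-- Collapsing the graph of groups structure of `A` to its image: the graph remains, the group of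
each vertex or edge becomes its image under `f`, and the structure maps are `ad (δ_e) ∘ ι_{f(e)}`,
restricted to these images. -/
def image : GraphOfGroups.{u} where
  toOrGraph := A.toOrGraph
  connected := A.connected
  VG v := (f.vhom v).range
  EG e := (f.edge e).hom.range
  ι e b := MonoidHom.codRestrict
    (((MulAut.conj ((f.edge e).δ b)).toMonoidHom.comp
      ((B.vcast ((f.edge e).ends b)).comp (B.cellι (f.edge e).cell b))).comp
        (f.edge e).hom.range.subtype)
    (f.vhom (A.endpt e b)).range
    (by
      rintro ⟨_, h, rfl⟩
      exact ⟨A.ι e b h, (f.edge e).natural b h⟩)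
  ι_injective e b := by
    intro x y h
    have h1 := congrArg Subtype.val h
    exact Subtype.ext (B.cellι_injective _ b (B.vcast_injective _
      ((MulAut.conj ((f.edge e).δ b)).injective h1)))

/-- The morphism `f_*` from `A` to the image of `f`: the identity on the graph, `f` on the groups,
all elements `δ` trivial. -/
def toImage : Morphism A f.image where
  onV v := @id f.image.V v
  vhom v := (f.vhom v).rangeRestrict
  edge e :=
    { cell := .edge e true
      ends := fun _ => rfl
      hom := (f.edge e).hom.rangeRestrict
      δ := fun _ => 1
      natural := fun b h => by
        simp only [one_mul, inv_one, mul_one]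
        exact Subtype.ext ((f.edge e).natural b h) }

/-- The morphism from the image of `f` to `B`: `f` on the graph, the inclusion on the groups, with
the same elements `δ` as `f`. -/
def fromImage : Morphism f.image B where
  onV := f.onV
  vhom (v : A.V) := (f.vhom v).range.subtype
  edge (e : A.E) :=
    { cell := (f.edge e).cell
      ends := (f.edge e).ends
      hom := (f.edge e).hom.range.subtype
      δ := (f.edge e).δ
      natural := fun _ _ => rfl }

end Morphism

end GraphOfGroups

/-! If `f` collapses `e` to a vertex `u`, naturality for the two orientations gives `f ι_e = ad(δ_e)
f_e` and `f ι_ē = ad(δ_ē) f_e` with the same `f_e` into the group at `u`. Hence `δ_ē δ_e⁻¹`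
conjugates `f ι_e` to `f ι_ē`. Sending a vertex group element `g` to `f_v(g)` and an oriented
collapsed edge `e` to `δ_ē δ_e⁻¹` therefore respects both homotopy relations (`pathEval_homotopic`),
so each component over `u` has its path groupoid mapped to the group at `u`. On loops at the
basepoints this gives the vertex homomorphisms of `f'`, which is `descend`.

Let `x_v` (`pathElt`) be the image of the chosen path `γ_v`. Then `f' q` is `ad(x_v) f_v` on the
group at `v` (`pi1Hom_vertHom`), so on an edge that survives `f'` keeps `f_e` and takes `x_{τ(e)}
δ_e` as its element. Consequently `f' q` is the twist of `f` by `g_v = x_v`, with `k_e = 1` on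
surviving edges and `k_e = (x_{τ(e)} δ_e)⁻¹` on collapsed ones in their chosen orientation
(`exists_edge_twist`). At a basepoint the chosen path is constant, so `x_v = 1`.

The factorization through the image is formal: `toImage` has trivial elements `δ`, and `fromImage`
consists of inclusions and collapses only what `f'` collapses.

All vertices of a component have the same image, but only up to a propositional equality;
evaluations therefore carry a target vertex `u` and a proof, so that all factors lie in one group.
-/

namespace GraphOfGroups

variable {A B : GraphOfGroups.{u}}

namespace Morphism

/-! ### Evaluating paths of collapsed edges in the target -/

theorem onV_endpt_of_mem (f : Morphism A B) {e : A.E} (he : e ∈ f.collapsedEdges) (b b' : Bool) :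
    f.onV (A.endpt e b) = f.onV (A.endpt e b') := by
  obtain ⟨w, hw⟩ := he
  have key : ∀ b, w = f.onV (A.endpt e b) := fun b => by
    have h := (f.edge e).ends b
    rw [hw] at h
    exact h
  rw [← key b, ← key b']

/-- The element of the group at `f v` that `f` assigns to a path from `v` all of whose edges are
collapsed; an edge `(e, b)` contributes `δ_{ē} δ_e⁻¹`. -/
def pathEval (f : Morphism A B) {v w : A.V} (p : Path A f.collapsedEdges v w) :
    ∀ u, f.onV v = u → B.VG u :=
  match p with
  | .pt g => fun _ h => B.vcast h (f.vhom _ g)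
  | .cons g e he b hv p => fun u h =>
      B.vcast h (f.vhom _ g) *
        (B.vcast ((congrArg f.onV hv).trans h) ((f.edge e).δ (!b)) *
          (B.vcast ((f.onV_endpt_of_mem he b (!b)).trans ((congrArg f.onV hv).trans h))
            ((f.edge e).δ b))⁻¹) *
        f.pathEval p u ((f.onV_endpt_of_mem he b (!b)).trans ((congrArg f.onV hv).trans h))

theorem pathEval_lmul (f : Morphism A B) {v w : A.V} (g : A.VG v)
    (p : Path A f.collapsedEdges v w) (u : B.V) (h : f.onV v = u) :
    f.pathEval (p.lmul g) u h = B.vcast h (f.vhom v g) * f.pathEval p u h := by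
  cases p <;> simp [Path.lmul, pathEval, mul_assoc]

theorem pathEval_append (f : Morphism A B) {v w x : A.V} (p : Path A f.collapsedEdges v w)
    (q : Path A f.collapsedEdges w x) (u : B.V) (h : f.onV v = u) (h' : f.onV w = u) :
    f.pathEval (p.append q) u h = f.pathEval p u h * f.pathEval q u h' := by
  induction p with
  | pt g => exact f.pathEval_lmul g q u h
  | cons g e he b hv p ih => simp only [Path.append, pathEval, ih q _ h', mul_assoc]

/-- The naturality conditions for the two orientations of a collapsed edge, combined. -/
theorem natural_of_mem (f : Morphism A B) {e : A.E} (he : e ∈ f.collapsedEdges) (b : Bool)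
    (u : B.V) (h0 : f.onV (A.endpt e (!b)) = u) (h1 : f.onV (A.endpt e b) = u) (h : A.EG e) :
    (B.vcast h0 ((f.edge e).δ (!b)) * (B.vcast h1 ((f.edge e).δ b))⁻¹) *
        B.vcast h1 (f.vhom _ (A.ι e b h)) =
      B.vcast h0 (f.vhom _ (A.ι e (!b) h)) *
        (B.vcast h0 ((f.edge e).δ (!b)) * (B.vcast h1 ((f.edge e).δ b))⁻¹) := by
  obtain ⟨w, hw⟩ := he
  rw [(f.edge e).natural b h, (f.edge e).natural (!b) h]
  simp only [map_mul, map_inv, vcast_vcast]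
  -- On a vertex cell both structure maps are the identity, so the two naturality equations contain
  -- the same element `f_e(h)`.
  have key : ∀ (x : B.Cell) (t : B.grp x) (p : x.endpt b = u) (q : x.endpt (!b) = u),
      x = .vert w → B.vcast p (B.cellι x b t) = B.vcast q (B.cellι x (!b) t) := by
    rintro x t p q rfl
    rfl
  rw [key _ _ _ (((f.edge e).ends (!b)).trans h0) hw]
  group

/-- Only the two generating relations need an argument. For `cancel`, the contributions `δ_ē δ_e⁻¹`
and `δ_e δ_ē⁻¹` of `e` and `ē` are inverse to each other; `slide` is `natural_of_mem`. -/
theorem pathEval_homotopic (f : Morphism A B) {v w : A.V} {p q : Path A f.collapsedEdges v w}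
    (h : p.Homotopic q) : f.pathEval p = f.pathEval q := by
  induction h with
  | refl p => rfl
  | symm _ ih => exact ih.symm
  | trans _ _ ih ih' => exact ih.trans ih'
  | congr g e he b hv h ih => simp only [pathEval, ih]
  | cancel e he b g hv p =>
    funext u h
    rw [pathEval_lmul]
    have key : ∀ {G : Type u} [Group G] (x a b p : G),
        x * (a * b⁻¹) * (1 * (b * a⁻¹) * p) = x * p := by
      intro G _ x a b p
      group
    simp only [pathEval, map_one]
    -- Splitting on `b` makes `!!b` reduce to `b`, so that the elements contributed by `e` and `ē`
    -- match syntactically.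
    cases b <;> exact key _ _ _ _
  | slide e he b g h p =>
    funext u hu
    have h1 := f.natural_of_mem he b u hu ((f.onV_endpt_of_mem he b (!b)).trans hu) h
    simp only [pathEval, pathEval_lmul, map_mul]
    rw [mul_assoc (B.vcast _ _) (B.vcast _ _), ← h1]
    simp only [mul_assoc]

/-- `pathEval` on homotopy classes. -/
def hpathEval (f : Morphism A B) {v w : A.V} (x : HPath A f.collapsedEdges v w) (u : B.V)
    (h : f.onV v = u) : B.VG u :=
  Quot.lift (fun p => f.pathEval p u h)
    (fun _ _ hpq => congrFun (congrFun (f.pathEval_homotopic hpq) u) h) x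

theorem hpathEval_trans (f : Morphism A B) {v w x : A.V} (p : HPath A f.collapsedEdges v w)
    (q : HPath A f.collapsedEdges w x) (u : B.V) (h : f.onV v = u) (h' : f.onV w = u) :
    f.hpathEval (p.trans q) u h = f.hpathEval p u h * f.hpathEval q u h' := by
  induction p using Quot.ind
  induction q using Quot.ind
  exact f.pathEval_append _ _ u h h'

theorem hpathEval_ofVert (f : Morphism A B) {v : A.V} (g : A.VG v) (u : B.V) (h : f.onV v = u) :
    f.hpathEval (HPath.ofVert _ g) u h = B.vcast h (f.vhom v g) := rfl

theorem hpathEval_ofEdge (f : Morphism A B) {e : A.E} (he : e ∈ f.collapsedEdges) (b : Bool)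
    (u : B.V) (h : f.onV (A.endpt e (!b)) = u) (h' : f.onV (A.endpt e b) = u) :
    f.hpathEval (HPath.ofEdge he b) u h =
      B.vcast h ((f.edge e).δ (!b)) * (B.vcast h' ((f.edge e).δ b))⁻¹ := by
  simp [hpathEval, HPath.ofEdge, HPath.mk, pathEval]

theorem hpathEval_const (f : Morphism A B) {v w : A.V} (hvw : v = w) (u : B.V)
    (h : f.onV v = u) : f.hpathEval (HPath.const f.collapsedEdges hvw) u h = 1 := by
  subst hvw
  exact (f.hpathEval_ofVert 1 u h).trans (by simp)

theorem hpathEval_symm (f : Morphism A B) {v w : A.V} (x : HPath A f.collapsedEdges v w)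
    (u : B.V) (h : f.onV w = u) (h' : f.onV v = u) :
    f.hpathEval x.symm u h = (f.hpathEval x u h')⁻¹ := by
  rw [eq_inv_iff_mul_eq_one, ← hpathEval_trans, HPath.symm_trans, hpathEval_ofVert, map_one,
    map_one]

/-- The homomorphism induced on the fundamental group of a component of the collapsed edges. -/
def pi1Hom (f : Morphism A B) (v : A.V) (u : B.V) (h : f.onV v = u) :
    Pi1 A f.collapsedEdges v →* B.VG u where
  toFun x := f.hpathEval x u h
  map_one' := (f.hpathEval_ofVert 1 u h).trans (by simp)
  map_mul' x y := f.hpathEval_trans x y u h h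

/-! ### The induced morphism on the collapsed graph of groups -/

theorem conj_conj {G : Type*} [Group G] (a b x : G) :
    a * (b * x * b⁻¹) * a⁻¹ = a * b * x * (a * b)⁻¹ := by
  group

variable (f : Morphism A B) (c : CollapseChoice A f.collapsedEdges)

/-- The map induced by `f` on the components of the subgraph of collapsed edges. -/
def compMap : A.Comp f.collapsedEdges → B.V :=
  Quot.lift f.onV (by rintro _ _ ⟨e, he, rfl, rfl⟩; exact f.onV_endpt_of_mem he _ _)

theorem onV_base (K : A.Comp f.collapsedEdges) : f.onV (c.base K) = f.compMap K :=
  congrArg f.compMap (c.base_mem K)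

theorem onV_base_comp (v : A.V) : f.onV (c.base (A.comp f.collapsedEdges v)) = f.onV v :=
  f.onV_base c _

/-- The image under `f` of the chosen path to `v`. -/
def pathElt (v : A.V) : B.VG (f.onV v) :=
  f.hpathEval (c.path v) (f.onV v) (f.onV_base_comp c v)

theorem pathElt_of_base {v : A.V} (h : c.base (A.comp _ v) = v) : f.pathElt c v = 1 := by
  rw [pathElt, c.path_base v h, hpathEval_const]

/-- This is evaluation of `γ_v g γ_v⁻¹`. It serves twice: as naturality of `descend`, and as the
statement that the vertex homomorphisms of `f' q` are those of `f` twisted by `pathElt`. -/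
theorem pi1Hom_vertHom (v : A.V) (g : A.VG v) :
    f.pi1Hom _ (f.onV v) (f.onV_base_comp c v) (c.vertHom v g) =
      f.pathElt c v * f.vhom v g * (f.pathElt c v)⁻¹ := by
  change f.hpathEval (((c.path v).trans (HPath.ofVert _ g)).trans (c.path v).symm) _ _ = _
  rw [f.hpathEval_trans _ _ _ _ rfl, f.hpathEval_trans _ _ _ _ rfl,
    f.hpathEval_symm _ _ _ (f.onV_base_comp c v)]
  rfl

/-- The morphism induced by `f` on the collapse of the subgraph of collapsed edges. -/
def descend : Morphism c.collapse B where
  onV := f.compMap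
  vhom K := f.pi1Hom (c.base K) (f.compMap K) (f.onV_base c K)
  edge e :=
    { cell := (f.edge e.1).cell
      ends := (f.edge e.1).ends
      hom := (f.edge e.1).hom
      -- The new structure map conjugates with the chosen path to the endpoint; the factor `pathElt`
      -- absorbs this conjugation.
      δ := fun b => f.pathElt c (A.endpt e.1 b) * (f.edge e.1).δ b
      natural := fun b h => by
        refine (f.pi1Hom_vertHom c _ _).trans ?_
        rw [(f.edge e.1).natural b h]
        exact conj_conj _ _ _ }

theorem descend_not_collapses (e : c.collapse.E) : ¬ (f.descend c).Collapses e := e.2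

/-! ### Equality of morphisms and factorization through the image -/

/-- The type of an edge map depends on the vertex homomorphisms, and the type of its `hom` on its
`cell`; both may agree only propositionally, hence `HEq`. The elements `δ` live in groups depending
on neither, so plain equality suffices for them. The remaining fields are proofs. -/
theorem edgeMap_heq {onV : A.V → B.V} {h₁ h₂ : ∀ v, A.VG v →* B.VG (onV v)} (hh : h₁ = h₂)
    {e : A.E} (d₁ : EdgeMap A B onV h₁ e) (d₂ : EdgeMap A B onV h₂ e)
    (hc : d₁.cell = d₂.cell) (hom : HEq d₁.hom d₂.hom) (hδ : ∀ b, d₁.δ b = d₂.δ b) :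
    HEq d₁ d₂ := by
  subst hh
  obtain ⟨c₁, _, m₁, δ₁, _⟩ := d₁
  obtain ⟨c₂, _, m₂, δ₂, _⟩ := d₂
  obtain rfl : δ₁ = δ₂ := funext hδ
  subst hc
  obtain rfl := eq_of_heq hom
  rfl

theorem mk_congr {onV : A.V → B.V} {h₁ h₂ : ∀ v, A.VG v →* B.VG (onV v)}
    {d₁ : ∀ e, EdgeMap A B onV h₁ e} {d₂ : ∀ e, EdgeMap A B onV h₂ e} (hh : h₁ = h₂)
    (hd : ∀ e, HEq (d₁ e) (d₂ e)) : Morphism.mk onV h₁ d₁ = Morphism.mk onV h₂ d₂ := by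
  subst hh
  congr
  exact funext fun e => eq_of_heq (hd e)

theorem fromImage_comp_toImage (f : Morphism A B) : f.fromImage.comp f.toImage = f := by
  refine mk_congr (h₂ := f.vhom) (d₂ := f.edge) rfl fun e => ?_
  refine edgeMap_heq rfl _ _ rfl HEq.rfl fun b => ?_
  exact (congrArg (· * _) (map_one _)).trans (one_mul _)

theorem fromImage_isStallings (f : Morphism A B) (hf : ∀ e, ¬ f.Collapses e) :
    f.fromImage.IsStallings :=
  ⟨hf, fun _ => Subtype.val_injective, fun _ => Subtype.val_injective⟩

theorem compEdge_fromImage_toImage_δ {C : GraphOfGroups.{u}} (f : Morphism B C)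
    {onV : A.V → B.V} {vhom : ∀ v, A.VG v →* B.VG (onV v)} {e : A.E} (d : EdgeMap A B onV vhom e)
    (b : Bool) :
    (f.fromImage.compEdge (f.toImage.compEdge d)).δ b = (f.compEdge d).δ b := by
  obtain ⟨x, ends, hom, δ, nat⟩ := d
  -- Here `y` stands for the transported element `δ` of `toImage`, which is trivial whether the cell
  -- is a vertex or an edge.
  have key : ∀ y : f.image.VG (f.toImage.onV (onV (A.endpt e b))), y = 1 →
      f.fromImage.vhom _ (f.toImage.vhom _ (δ b) * y) = f.vhom _ (δ b) := by
    rintro _ rfl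
    exact congrArg (f.fromImage.vhom _) (mul_one _)
  have key' := key _ (map_one (f.image.vcast (congrArg f.toImage.onV (ends b))))
  cases x with
  | vert v =>
    exact congrArg (· * C.vcast (congrArg f.onV (ends b)) (f.cellδ (.vert v) b)) key'
  | edge e' c =>
    cases c <;>
      exact congrArg (· * C.vcast (congrArg f.onV (ends b)) (f.cellδ (.edge e' _) b)) key'

/-- With this bracketing `fromImage_comp_toImage` does not apply directly, so cells, homomorphisms
and elements `δ` are compared separately. -/
theorem fromImage_comp_toImage_comp {C : GraphOfGroups.{u}} (f : Morphism B C)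
    (q : Morphism A B) : f.fromImage.comp (f.toImage.comp q) = f.comp q := by
  refine mk_congr (h₂ := (f.comp q).vhom) (d₂ := (f.comp q).edge) rfl fun e => ?_
  refine edgeMap_heq rfl _ _ ?_ ?_ fun b => ?_
  · change f.fromImage.cellMap (f.toImage.cellMap (q.edge e).cell) = f.cellMap (q.edge e).cell
    generalize (q.edge e).cell = x
    cases x with
    | vert v => rfl
    | edge e c => cases c <;> rfl
  · change HEq ((f.fromImage.cellHom (f.toImage.cellMap (q.edge e).cell)).comp
      ((f.toImage.cellHom (q.edge e).cell).comp (q.edge e).hom))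
      ((f.cellHom (q.edge e).cell).comp (q.edge e).hom)
    -- The homomorphism is generalized before the cell because its type mentions the cell; once the
    -- cell and its orientation are explicit, both sides coincide by computation.
    generalize (q.edge e).hom = φ
    revert φ
    generalize (q.edge e).cell = x
    intro φ
    cases x with
    | vert v => rfl
    | edge e c => cases c <;> rfl
  · exact f.compEdge_fromImage_toImage_δ (q.edge e) b

/-! ### The twisting elements and the equivalence -/

/-- The image cell of a collapsed edge is a vertex only propositionally, while a twisting element
must lie in the group of that cell. The element `k` is `a` transported there; the two properties are
what is needed to compare the elements `δ` and the edge homomorphisms after twisting. -/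
theorem exists_grp_of_eq_vert {H : Type u} [Group H] {x : B.Cell} {v : B.V} (hx : x = .vert v)
    (a : B.VG v) :
    ∃ k : B.grp x,
      (∀ (b : Bool) (u : B.V) (h : x.endpt b = u) (h' : v = u),
        B.vcast h (B.cellι x b k) = B.vcast h' a) ∧
      ∀ (φ : H →* B.grp x) (ψ : H →* B.VG v) (h : x.endpt true = v),
        (∀ t, ψ t = a⁻¹ * B.vcast h (B.cellι x true (φ t)) * a) →
          HEq ψ ((MulAut.conj k⁻¹).toMonoidHom.comp φ) := by
  subst hx
  refine ⟨a, fun b u h h' => rfl, fun φ ψ h hψ => heq_of_eq (MonoidHom.ext fun t => ?_)⟩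
  refine (hψ t).trans ?_
  exact congrArg (a⁻¹ * (show B.VG v from φ t) * ·) (inv_inv a).symm

/-- Evaluate `γ e γ'⁻¹` factor by factor. The constant path at the end of `edgeElt` only identifies
two equal basepoints and contributes `1`. -/
theorem pi1Hom_edgeElt {e : A.E} (he : e ∈ f.collapsedEdges) (b : Bool) :
    f.pi1Hom _ (f.onV (A.endpt e (!b))) (f.onV_base_comp c _) (c.edgeElt he b) =
      f.pathElt c _ * ((f.edge e).δ (!b) *
        (B.vcast (f.onV_endpt_of_mem he b (!b)) ((f.edge e).δ b))⁻¹) *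
        (B.vcast (f.onV_endpt_of_mem he b (!b)) (f.pathElt c (A.endpt e b)))⁻¹ := by
  have h0 := f.onV_endpt_of_mem he b (!b)
  have h1 : f.hpathEval (c.path (A.endpt e b)) _ ((f.onV_base_comp c _).trans h0) =
      B.vcast h0 (f.pathElt c (A.endpt e b)) := by
    have : ∀ (u : B.V) (h : f.onV (A.endpt e b) = u),
        f.hpathEval (c.path (A.endpt e b)) u ((f.onV_base_comp c _).trans h) =
          B.vcast h (f.pathElt c (A.endpt e b)) := by
      rintro u rfl
      rfl
    exact this _ h0
  change f.hpathEval ((((c.path (A.endpt e (!b))).trans (HPath.ofEdge he b)).trans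
    (c.path (A.endpt e b)).symm).trans
      (HPath.const _ (congrArg c.base (A.comp_endpt he b (!b))))) _ _ = _
  rw [f.hpathEval_trans _ _ _ _ ((f.onV_base_comp c _).trans h0), f.hpathEval_const, mul_one,
    f.hpathEval_trans _ _ _ _ h0, f.hpathEval_trans _ _ _ _ rfl,
    f.hpathEval_symm _ _ _ ((f.onV_base_comp c _).trans h0), f.hpathEval_ofEdge he b _ rfl h0, h1]
  rfl

/-- A twist takes a whole family `k`, but its part at `e` depends on `k e` alone. Quantifying over
all families with the prescribed value at `e` lets the values be found edge by edge and assembled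
afterwards. -/
theorem exists_edge_twist (e : A.E) :
    ∃ k₀ : B.grp (f.edge e).cell, ∀ k : ∀ e, B.grp (f.edge e).cell, k e = k₀ →
      HEq (((f.descend c).comp c.quotientMap).edge e) ((f.twist (f.pathElt c) k).edge e) := by
  have hh : ((f.descend c).comp c.quotientMap).vhom = (f.twist (f.pathElt c) 1).vhom :=
    funext fun v => MonoidHom.ext fun g => f.pi1Hom_vertHom c v g
  by_cases he : e ∈ f.collapsedEdges
  · have hq : c.quotientMap.edge e = c.quotientEdgeOfMem he := dif_pos he
    have hcell : (f.edge e).cell = .vert (f.onV (A.endpt e true)) := by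
      obtain ⟨w, hw⟩ := he
      have h := (f.edge e).ends true
      rw [hw] at h ⊢
      exact congrArg _ h
    -- This value is forced: the quotient morphism has trivial `δ` on the chosen orientation, so
    -- `x_{τ(e)} δ_e k_e` must be `1`.
    obtain ⟨k₀, hk, hhom⟩ := exists_grp_of_eq_vert (H := A.EG e) hcell
      (f.pathElt c (A.endpt e true) * (f.edge e).δ true)⁻¹
    refine ⟨k₀, fun k hke => ?_⟩
    have h2 : HEq ((f.descend c).compEdge (c.quotientEdgeOfMem he))
        ((f.twist (f.pathElt c) k).edge e) := by
      refine edgeMap_heq hh _ _ hcell.symm ?_ fun b => ?_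
      · subst hke
        refine hhom (f.edge e).hom _ ((f.edge e).ends true) fun t => ?_
        refine (f.pi1Hom_vertHom c _ _).trans ?_
        rw [(f.edge e).natural true t, inv_inv]
        exact conj_conj _ _ _
      · subst hke
        have h3 := hk b _ ((f.edge e).ends b) (f.onV_endpt_of_mem he true b)
        cases b
        -- On the reverse orientation the same `k_e` turns `x δ_ē k_e` into `x δ_ē δ_e⁻¹
        -- x_{τ(e)}⁻¹`, with `x` taken at the initial vertex of `e`; this is the image of the
        -- element `δ_ē` of the quotient morphism.
        · refine (congrArg (_ * ·) (map_one _)).trans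
            ((mul_one _).trans ((f.pi1Hom_edgeElt c he true).trans ?_))
          change _ = _ * _ * _
          rw [h3, map_inv, map_mul, mul_inv_rev]
          simp only [mul_assoc]
          rfl
        · refine (mul_one _).trans ((map_one _).trans ?_)
          change _ = _ * _ * _
          rw [h3]
          exact (mul_inv_cancel _).symm
    exact (heq_of_eq (congrArg (f.descend c).compEdge hq)).trans h2
  · have hq : c.quotientMap.edge e = c.quotientEdgeOfNotMem he := dif_neg he
    -- A surviving edge needs no twist of its own: `descend` keeps `f_e`, and its element `δ`
    -- already contains the factor `pathElt`.
    refine ⟨1, fun k hke => ?_⟩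
    have h2 : HEq ((f.descend c).compEdge (c.quotientEdgeOfNotMem he))
        ((f.twist (f.pathElt c) k).edge e) := by
      refine edgeMap_heq hh _ _ rfl (heq_of_eq (MonoidHom.ext fun t => ?_)) fun b => ?_
      · change (f.edge e).hom t = (k e)⁻¹ * (f.edge e).hom t * (k e)⁻¹⁻¹
        simp [hke]
      · change f.pi1Hom _ (f.onV (A.endpt e b)) (f.onV_base_comp c _) 1 * (f.pathElt c (A.endpt e b) * (f.edge e).δ b) =
          f.pathElt c (A.endpt e b) * (f.edge e).δ b *
            B.vcast ((f.edge e).ends b) (B.cellι (f.edge e).cell b (k e))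
        rw [hke, map_one, map_one, map_one, mul_one]
        exact one_mul _
    exact (heq_of_eq (congrArg (f.descend c).compEdge hq)).trans h2

theorem equivFixing_descend_comp_quotientMap :
    f.EquivFixing ((f.descend c).comp c.quotientMap) (Set.range c.base) := by
  choose k hk using f.exists_edge_twist c
  refine ⟨f.pathElt c, k, ?_, ?_⟩
  · rintro _ ⟨K, rfl⟩
    -- The basepoint of the component of `c.base K` is `c.base K` itself, so the chosen path to it
    -- is constant.
    exact f.pathElt_of_base c (congrArg c.base (c.base_mem K))
  · exact mk_congr (d₁ := ((f.descend c).comp c.quotientMap).edge)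
      (d₂ := (f.twist (f.pathElt c) k).edge)
      (funext fun v => MonoidHom.ext fun g => f.pi1Hom_vertHom c v g) fun e => hk e k rfl

end Morphism
end GraphOfGroups

theorem mainTheorem11 {A B : GraphOfGroups.{u}} (f : GraphOfGroups.Morphism A B)
    (c : GraphOfGroups.CollapseChoice A f.collapsedEdges) :
    ∃ f' : GraphOfGroups.Morphism c.collapse B,
      (∀ e, ¬ f'.Collapses e) ∧
      f'.fromImage.comp f'.toImage = f' ∧
      f'.fromImage.IsStallings ∧
      f.EquivFixing (f'.fromImage.comp (f'.toImage.comp c.quotientMap)) (Set.range c.base) := by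
  refine ⟨f.descend c, f.descend_not_collapses c, (f.descend c).fromImage_comp_toImage,
    (f.descend c).fromImage_isStallings (f.descend_not_collapses c), ?_⟩
  rw [GraphOfGroups.Morphism.fromImage_comp_toImage_comp]
  exact f.equivFixing_descend_comp_quotientMap c
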